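/- **Theorem (Convergence of the CRS algorithm).** Consider followers $1,\dots,n$ and a leader $n+1$ with communication topology a directed graph $\mathcal G$ on $\{1,\dots,n+1\}$. Write $j\in\mathcal N_i$, $a_{ij}=1$, if there is an edge from $j$ to $i$ (agent $i$ receives information from $j$), and $a_{ij}=0$ otherwise; $d_i=|\mathcal N_i|$, $d_*=\max_{1\le i\le n}d_i$, and $\mathcal L=\mathrm{diag}(d_1,\dots,d_{n+1})-(a_{ij})$. The leader receives nothing from the followers: $a_{(n+1)j}=0$ for $j\le n$. *System and algorithm.* Let $\mathcal W\ge 0$, thresholds $\mathcal B_{ij}$, a real sequence $f(k)$ and a coefficient $\beta$ be given, let $\mathcal F$ and $f_\xi$ be the distribution function and the density of $N(0,\sigma^2)$, $\sigma>0$, and let $\Pi_{\mathcal W}$ be the projection of $\mathbb R$ onto $[-\mathcal W,\mathcal W]$. The initial values $x_i(0)$, $i\le n+1$, and $\hat x_{ij}(0)$, $i\le n$, $j\in\mathcal N_i$, are deterministic, with $|x_i(0)|\le\mathcal W$ for $i\le n$ and $|\hat x_{ij}(0)|\le\mathcal W$. For $k\ge 0$, $$x_{n+1}(k+1)=x_{n+1}(k)+f(k),\qquad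 x_i(k+1)=x_i(k)-\frac1{k+1}\sum_{j=1}^{n+1}a_{ij}\bigl(x_i(k)-\hat x_{ij}(k)\bigr)\quad(1\le i\le n),$$ and for $k\ge1$, $1\le i\le n$, $j\in\mathcal N_i$, $$\hat x_{ij}(k)=\Pi_{\mathcal W}\Bigl\{\hat x_{ij}(k-1)+\frac\beta k\bigl(\mathcal F(\mathcal B_{ij}-\hat x_{ij}(k-1))-\mathcal S_{ij}(k)\bigr)\Bigr\},\qquad \mathcal S_{ij}(k)=\mathbf 1_{\{x_j(k)+\xi_{ij}(k)\le\mathcal B_{ij}\}} .$$ *Assumptions.* (1) $\mathcal G$ contains a directed spanning tree whose root is the leader. (2) Each noise $\xi_{ij}(k)$ ($k\ge1$, $i\le n$, $j\in\mathcal N_i$) has law $N(0,\sigma^2)$ and is independent of the state of the system on which it acts, i.e. of all the $x_p(k)$ and all the $\hat x_{pq}(k-1)$ jointly. (3) $x_{n+1}(k)\to x^*$ for a constant $x^*$ with $|x^*|\le\mathcal W$. *Constants.* Let $\pi$ be the row vector with $\pi\mathcal L=0$ and $\pi\mathbf 1=1$, and $J=\mathbf 1\pi$. Let $\Theta=[q,\psi]$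 be an invertible (real or complex) matrix with first column $q$ and with inverse $\Theta^{-1}$ whose first row is $\tau$ and whose other rows form the $n\times(n+1)$ matrix $\phi$, such that $\Theta^{-1}\mathcal L\Theta=\mathrm{diag}(0,\tilde{\mathcal L})$ (e.g. a Jordan form). Let $\kappa>0$ and let $H$ be a positive definite Hermitian matrix with $H\tilde{\mathcal L}+\tilde{\mathcal L}^{*}H=\kappa I$, where ${}^*$ is the conjugate transpose. Let $W$ be the matrix with one row for each pair $(i,j)$ with $j\in\mathcal N_i$, that row being the $j$-th unit vector. Put $\lambda_H=\lambda_{\max}(H)$, $h=1/\lambda_{\min}(H)$, $\lambda_\phi=\lambda_{\max}\bigl((I-J)^{*}\phi^{*}H\phi(I-J)\bigr)$, $\lambda_W=\lambda_{\max}(WW^T)$, $\lambda_L=\lambda_{\max}(\mathcal L\mathcal L^T)$, $B=\max_{i\le n,\,j\in\mathcal N_i}|\mathcal B_{ij}|$, $f_B=f_\xi(B+\mathcal W)$, and $$l_1=\frac{h\lambda_W\lambda_L}{4\lambda_H\lambda_\phi d_*}+4\lambda_\phi^2\lambda_H^3d_*^2+d_* .$$ *Conclusion.* If $\beta>l_1/f_B$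 then, as $k\to\infty$, $$E\bigl(\hat x_{ij}(k)-x_j(k)\bigr)^2\to0\quad\text{for all } 1\le i\le n,\ j\in\mathcal N_i,\ j\ne i,$$ $$E\bigl(x_i(k)-x_{n+1}(k)\bigr)^2\to0\quad\text{for all } 1\le i\le n+1 .$$ -/

import Mathlib

open MeasureTheory ProbabilityTheory Filter Topology
open scoped NNReal Matrix ComplexOrder

namespace BinaryTracking

/-! ### The communication topology

Agents are indexed by `Fin (n + 1)`; the followers are `i.castSucc` for `i : Fin n`, and the leader is
`Fin.last n`. `G.Adj j i` means that there is an edge from `j` to `i`, i.e. that agent `i` receives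
information from agent `j`. -/

/-- The neighbours `N_i` of agent `i`: the agents `j` with an edge from `j` to `i`. -/
noncomputable def neighbors {n : ℕ} (G : Digraph (Fin (n + 1))) (i : Fin (n + 1)) :
    Finset (Fin (n + 1)) := by
  classical exact Finset.univ.filter (fun j => G.Adj j i)

/-- The number `d_i` of neighbours of agent `i`. -/
noncomputable def inDeg {n : ℕ} (G : Digraph (Fin (n + 1))) (i : Fin (n + 1)) : ℕ :=
  (neighbors G i).card

/-- The adjacency matrix: `a_ij = 1` if there is an edge from `j` to `i`, and `0` otherwise. -/
noncomputable def adjacency {n : ℕ} (G : Digraph (Fin (n + 1))) :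
    Matrix (Fin (n + 1)) (Fin (n + 1)) ℝ :=
  Matrix.of fun i j => if j ∈ neighbors G i then 1 else 0

/-- The Laplacian `D - A`. -/
noncomputable def laplacian {n : ℕ} (G : Digraph (Fin (n + 1))) :
    Matrix (Fin (n + 1)) (Fin (n + 1)) ℝ :=
  Matrix.diagonal (fun i => (inDeg G i : ℝ)) - adjacency G

/-- The largest number of neighbours of a follower. -/
noncomputable def maxDeg {n : ℕ} (G : Digraph (Fin (n + 1))) : ℕ :=
  Finset.univ.sup fun i : Fin n => inDeg G i.castSucc

/-- `T` is a directed tree rooted at `r` which spans all vertices: no edge enters `r`, exactly one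
edge enters every other vertex, and every vertex can be reached from `r` along edges of `T`. -/
def IsSpanningTree {V : Type*} (T : Digraph V) (r : V) : Prop :=
  (∀ u, ¬ T.Adj u r) ∧ (∀ v, v ≠ r → ∃! u, T.Adj u v) ∧ ∀ v, Relation.ReflTransGen T.Adj r v

/-- The index set of the pairs `(i, j)` with `j ∈ N_i`. -/
abbrev Edge {n : ℕ} (G : Digraph (Fin (n + 1))) : Type :=
  {e : Fin (n + 1) × Fin (n + 1) // e.2 ∈ neighbors G e.1}

/-- The matrix `W` whose row with index `(i, j)`, `j ∈ N_i`, is the `j`-th unit vector. -/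
def edgeMatrix {n : ℕ} (G : Digraph (Fin (n + 1))) : Matrix (Edge G) (Fin (n + 1)) ℝ :=
  Matrix.of fun e p => if p = e.1.2 then 1 else 0

/-! ### Spectral and Lyapunov data -/

/-- The largest eigenvalue of a Hermitian matrix. -/
noncomputable def lambdaMax {𝕜 m : Type*} [RCLike 𝕜] [Fintype m] [DecidableEq m]
    {A : Matrix m m 𝕜} (hA : A.IsHermitian) : ℝ :=
  ⨆ i, hA.eigenvalues i

/-- The smallest eigenvalue of a Hermitian matrix. -/
noncomputable def lambdaMin {𝕜 m : Type*} [RCLike 𝕜] [Fintype m] [DecidableEq m]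
    {A : Matrix m m 𝕜} (hA : A.IsHermitian) : ℝ :=
  ⨅ i, hA.eigenvalues i

/-- A choice of the data from which the constants are computed: the normalized left null vector `π` of
the Laplacian `L`; an invertible matrix `Θ = [q, ψ]` with inverse `[τ; φ]` such that
`Θ⁻¹ L Θ = diag(0, L̃)` (for instance a Jordan form of `L`); and a solution `H > 0` of the Lyapunov
equation `H L̃ + L̃ᴴ H = κ I` for some `κ > 0`. The scalars are real or complex, as a Jordan form may
need complex numbers. -/
structure LyapunovData (𝕜 : Type*) [RCLike 𝕜] {n : ℕ} (G : Digraph (Fin (n + 1))) where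
  π : Fin (n + 1) → ℝ
  π_left : π ᵥ* laplacian G = 0
  π_sum : ∑ i, π i = 1
  q : Fin (n + 1) → 𝕜
  ψ : Matrix (Fin (n + 1)) (Fin n) 𝕜
  τ : Fin (n + 1) → 𝕜
  φ : Matrix (Fin n) (Fin (n + 1)) 𝕜
  rank_ψ : ψ.rank = (laplacian G).rank
  mul_inv : Matrix.fromCols (Matrix.replicateCol Unit q) ψ *
    Matrix.fromRows (Matrix.replicateRow Unit τ) φ = 1
  inv_mul : Matrix.fromRows (Matrix.replicateRow Unit τ) φ *
    Matrix.fromCols (Matrix.replicateCol Unit q) ψ = 1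
  Lt : Matrix (Fin n) (Fin n) 𝕜
  block : Matrix.fromRows (Matrix.replicateRow Unit τ) φ *
      (laplacian G).map (fun r : ℝ => (r : 𝕜)) *
      Matrix.fromCols (Matrix.replicateCol Unit q) ψ = Matrix.fromBlocks 0 0 0 Lt
  κ : ℝ
  κ_pos : 0 < κ
  H : Matrix (Fin n) (Fin n) 𝕜
  H_posDef : H.PosDef
  lyapunov : H * Lt + Ltᴴ * H = (κ : 𝕜) • (1 : Matrix (Fin n) (Fin n) 𝕜)

namespace LyapunovData

variable {𝕜 : Type*} [RCLike 𝕜] {n : ℕ} {G : Digraph (Fin (n + 1))}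

/-- The matrix `φ (I - J)`, where all rows of `J` are equal to `π`. -/
noncomputable def φJ (D : LyapunovData 𝕜 G) : Matrix (Fin n) (Fin (n + 1)) 𝕜 :=
  D.φ * (1 - Matrix.of fun _ j => (D.π j : 𝕜))

/-- `λ_H`, the largest eigenvalue of `H`. -/
noncomputable def lamH (D : LyapunovData 𝕜 G) : ℝ := lambdaMax D.H_posDef.isHermitian

/-- `h = 1 / λ_min(H)`. -/
noncomputable def h (D : LyapunovData 𝕜 G) : ℝ := 1 / lambdaMin D.H_posDef.isHermitian

/-- `λ_φ`, the largest eigenvalue of `(I - J)ᴴ φᴴ H φ (I - J)`. -/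
noncomputable def lamφ (D : LyapunovData 𝕜 G) : ℝ :=
  lambdaMax (Matrix.isHermitian_conjTranspose_mul_mul D.φJ D.H_posDef.isHermitian)

end LyapunovData

/-- `λ_W`, the largest eigenvalue of `W Wᵀ`. -/
noncomputable def lamW {n : ℕ} (G : Digraph (Fin (n + 1))) : ℝ :=
  lambdaMax (Matrix.isHermitian_mul_conjTranspose_self (edgeMatrix G))

/-- `λ_L`, the largest eigenvalue of `L Lᵀ`. -/
noncomputable def lamL {n : ℕ} (G : Digraph (Fin (n + 1))) : ℝ :=
  lambdaMax (Matrix.isHermitian_mul_conjTranspose_self (laplacian G))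

/-- The constant
`l₁ = h λ_W λ_L / (4 λ_H λ_φ d) + 4 λ_φ² λ_H³ d² + d`, `d` the largest number of neighbours. -/
noncomputable def l₁ {𝕜 : Type*} [RCLike 𝕜] {n : ℕ} {G : Digraph (Fin (n + 1))}
    (D : LyapunovData 𝕜 G) : ℝ :=
  D.h * lamW G * lamL G / (4 * D.lamH * D.lamφ * (maxDeg G : ℝ)) +
    4 * D.lamφ ^ 2 * D.lamH ^ 3 * (maxDeg G : ℝ) ^ 2 + (maxDeg G : ℝ)

/-! ### The closed-loop system -/

/-- The parameters of the tracking problem and of the algorithm. -/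
structure Params (n : ℕ) where
  /-- the topology -/
  G : Digraph (Fin (n + 1))
  /-- the bound of the projection -/
  W : ℝ
  /-- the coefficient of the estimation step size -/
  β : ℝ
  /-- the variance of the noises -/
  v : ℝ≥0
  /-- the sensor thresholds `B_ij` -/
  B : Fin n → Fin (n + 1) → ℝ
  /-- the change rate of the leader's state -/
  f : ℕ → ℝ
  /-- the initial states, including that of the leader -/
  x0 : Fin (n + 1) → ℝ
  /-- the initial estimates -/
  xhat0 : Fin n → Fin (n + 1) → ℝ

namespace Params

variable {n : ℕ} (P : Params n)

/-- The projection onto `[-W, W]`. -/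
noncomputable def proj (y : ℝ) : ℝ := max (-P.W) (min P.W y)

/-- The distribution function of the noise. -/
noncomputable def F (y : ℝ) : ℝ := cdf (gaussianReal 0 P.v) y

/-- `f_B`: the density of the noise at `B + W`, where `B = max |B_ij|` over the pairs of a follower `i`
and a neighbour `j` of `i`. -/
noncomputable def fB : ℝ :=
  gaussianPDFReal 0 P.v
    ((⨆ e : {e : Fin n × Fin (n + 1) // e.2 ∈ neighbors P.G e.1.castSucc}, |P.B e.1.1 e.1.2|) + P.W)

/-- The state of the leader, `x_{n+1}(k + 1) = x_{n+1}(k) + f(k)`. -/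
noncomputable def leaderState (k : ℕ) : ℝ := P.x0 (Fin.last n) + ∑ s ∈ Finset.range k, P.f s

/-- The states of all agents at time `k + 1`, from the states and the estimates at time `k`:
`x_i(k + 1) = x_i(k) - 1/(k + 1) ∑_j a_ij (x_i(k) - x̂_ij(k))` for a follower. -/
noncomputable def nextState (k : ℕ) (x : Fin (n + 1) → ℝ) (xhat : Fin n → Fin (n + 1) → ℝ) :
    Fin (n + 1) → ℝ :=
  Fin.snoc (α := fun _ => ℝ)
    (fun i : Fin n => x i.castSucc -
      1 / ((k : ℝ) + 1) * ∑ j, adjacency P.G i.castSucc j * (x i.castSucc - xhat i j))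
    (x (Fin.last n) + P.f k)

/-- The binary observation `S_ij` (`1` if `x_j + ξ_ij ≤ B_ij`, and `0` otherwise). -/
noncomputable def obs (i : Fin n) (j : Fin (n + 1)) (xj noise : ℝ) : ℝ :=
  if xj + noise ≤ P.B i j then 1 else 0

/-- The estimates at time `k + 1`, from the estimates at time `k`, the states at time `k + 1` and the
noises at time `k + 1`. There is no estimate for a pair `(i, j)` with `j ∉ N_i`; that entry
is set to `0`. -/
noncomputable def nextEstimate (k : ℕ) (xhat : Fin n → Fin (n + 1) → ℝ) (x' : Fin (n + 1) → ℝ)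
    (noise : Fin n → Fin (n + 1) → ℝ) : Fin n → Fin (n + 1) → ℝ := fun i j =>
  if j ∈ neighbors P.G i.castSucc then
    P.proj (xhat i j +
      P.β / ((k : ℝ) + 1) * (P.F (P.B i j - xhat i j) - P.obs i j (x' j) (noise i j)))
  else 0

/-- The states and the estimates at time `k` along a realization `ξ` of the noises. -/
noncomputable def traj (ξ : ℕ → Fin n → Fin (n + 1) → ℝ) :
    ℕ → (Fin (n + 1) → ℝ) × (Fin n → Fin (n + 1) → ℝ)
  | 0 => (P.x0, fun i j => if j ∈ neighbors P.G i.castSucc then P.xhat0 i j else 0)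
  | k + 1 =>
    let z := traj ξ k
    let x' := P.nextState k z.1 z.2
    (x', P.nextEstimate k z.2 x' (ξ (k + 1)))

/-- The states `x_i(k)`, for noises `ξ_ij(k)` on a probability space. -/
noncomputable def x {Ω : Type*} (ξ : ℕ → Fin n → Fin (n + 1) → Ω → ℝ) (k : ℕ) (ω : Ω) :
    Fin (n + 1) → ℝ :=
  (P.traj (fun s i j => ξ s i j ω) k).1

/-- The estimates `x̂_ij(k)`, for noises `ξ_ij(k)` on a probability space. -/
noncomputable def xhat {Ω : Type*} (ξ : ℕ → Fin n → Fin (n + 1) → Ω → ℝ) (k : ℕ) (ω : Ω) :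
    Fin n → Fin (n + 1) → ℝ :=
  (P.traj (fun s i j => ξ s i j ω) k).2

theorem x_last {Ω : Type*} (ξ : ℕ → Fin n → Fin (n + 1) → Ω → ℝ) (k : ℕ) (ω : Ω) :
    P.x ξ k ω (Fin.last n) = P.leaderState k := by
  induction k with
  | zero => simp [x, traj, leaderState]
  | succ k ih =>
    have : P.x ξ (k + 1) ω (Fin.last n) = P.x ξ k ω (Fin.last n) + P.f k := by
      simp [x, traj, nextState]
    rw [this, ih, leaderState, leaderState, Finset.sum_range_succ, add_assoc]

end Params

/-- The assumption on the noises: for a follower `i`, a neighbour `j` of `i` and a time `k ≥ 1`, the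
noise `ξ_ij(k)` is a centred Gaussian variable with variance `v`, and it is independent of the state
`(x(k), x̂(k - 1))` of the system on which it acts. -/
def GaussianNoise {n : ℕ} (P : Params n) {Ω : Type*} [MeasurableSpace Ω] (μ : Measure Ω)
    (ξ : ℕ → Fin n → Fin (n + 1) → Ω → ℝ) : Prop :=
  ∀ (k : ℕ) (i : Fin n), ∀ j ∈ neighbors P.G i.castSucc,
    Measurable (ξ (k + 1) i j) ∧ μ.map (ξ (k + 1) i j) = gaussianReal 0 P.v ∧
      IndepFun (ξ (k + 1) i j) (fun ω => (P.x ξ (k + 1) ω, P.xhat ξ k ω)) μ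

end BinaryTracking

/-!
All quantities are compared with the limit `xstar` of the leader's state. Write `y_ij = x̂_ij - xstar` and
`δ_j = x_j - xstar`. On average and to first order in `1 / k`, an estimate `y_ij` is pulled towards `δ_j`
by the increment of the distribution function, whose slope is bounded below on the range of the
projection, and `δ_i` is pulled towards the average of its `y_ij`, `j ∈ N_i`. So the closed loop is a
consensus system anchored at the leader, where `δ_{n+1} → 0`, and a maximum principle shows that it
contracts for every positive step coefficient. The coefficient is positive because `l₁ ≥ 0`
(`l₁_nonneg`).

The noise is only assumed to be independent of the current state, so that there is no martingale to work
with pathwise; the maximum principle is therefore carried out in mean square. Call `τ ≥ 0` an asymptotic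
bound for random variables `u(k)` if the mean square of the distance of `u(k)` to `[-τ, τ]`, which is
`E (excess τ u(k))²`, tends to `0`.

* If `τ` is an asymptotic bound for `δ_j`, then it is one for `y_ij` (`tendsto_excess_xhat`). Since
  `(excess τ ·)²` is smooth with gradient `2 * excess τ`, one step of the algorithm adds the drift, which is
  contracting outside `[-τ, τ]` up to the excess of `δ_j` (`excess_mul_cdf_sub_le`), a noise term of mean
  zero (`integral_mul_cdf_sub_indicator`), and `O(1 / k²)`. The recursion is summed up by
  `tendsto_zero_of_recursion`.
* If `τ_j` is an asymptotic bound for `y_ij`, `j ∈ N_i`, then the average of the `τ_j` is one for `δ_i`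
  (`tendsto_excess_x`), by convexity of the squared distance (`excess_sq_sum_le`).

Hence the least asymptotic bounds `t_i` of the `δ_i` satisfy `t_i ≤ (∑_{j ∈ N_i} t_j) / d_i` for the
followers, and `t = 0` at the leader. Where `t` is maximal it is maximal at all neighbours as well, and
following the spanning tree back to the leader gives `t = 0` (`tendsto_x`).
-/

namespace BinaryTracking

/-! ### Sign of the constant -/

theorem lambdaMax_nonneg {𝕜 m : Type*} [RCLike 𝕜] [Fintype m] [DecidableEq m]
    {A : Matrix m m 𝕜} (hA : A.PosSemidef) (h : A.IsHermitian) : 0 ≤ lambdaMax h :=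
  Real.iSup_nonneg fun i => hA.eigenvalues_nonneg i

theorem lambdaMin_nonneg {𝕜 m : Type*} [RCLike 𝕜] [Fintype m] [DecidableEq m]
    {A : Matrix m m 𝕜} (hA : A.PosSemidef) (h : A.IsHermitian) : 0 ≤ lambdaMin h :=
  Real.iInf_nonneg fun i => hA.eigenvalues_nonneg i

theorem l₁_nonneg {𝕜 : Type*} [RCLike 𝕜] {n : ℕ} {G : Digraph (Fin (n + 1))}
    (D : LyapunovData 𝕜 G) : 0 ≤ l₁ D := by
  have h1 : 0 ≤ D.lamH := lambdaMax_nonneg D.H_posDef.posSemidef _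
  have h2 : 0 ≤ D.h := one_div_nonneg.2 (lambdaMin_nonneg D.H_posDef.posSemidef _)
  have h3 : 0 ≤ D.lamφ :=
    lambdaMax_nonneg (D.H_posDef.posSemidef.conjTranspose_mul_mul_same D.φJ) _
  have h4 : 0 ≤ lamW G := lambdaMax_nonneg (Matrix.posSemidef_self_mul_conjTranspose _) _
  have h5 : 0 ≤ lamL G := lambdaMax_nonneg (Matrix.posSemidef_self_mul_conjTranspose _) _
  unfold l₁
  positivity

theorem Params.fB_nonneg {n : ℕ} (P : Params n) : 0 ≤ P.fB := gaussianPDFReal_nonneg _ _ _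

/-! ### Soft thresholding -/

/-- The soft thresholding of `u` at level `τ ≥ 0`: the difference between `u` and the point of
`[-τ, τ]` nearest to it, so that `|excess τ u| = max (|u| - τ) 0`. -/
noncomputable def excess (τ u : ℝ) : ℝ := u - max (-τ) (min τ u)

theorem abs_sub_excess_le {τ : ℝ} (hτ : 0 ≤ τ) (u : ℝ) : |u - excess τ u| ≤ τ := by
  have : u - excess τ u = max (-τ) (min τ u) := by simp [excess]
  rw [this, abs_le]
  exact ⟨le_max_left _ _, max_le (by linarith) (min_le_left _ _)⟩

theorem excess_sq_le {τ c : ℝ} (hc : |c| ≤ τ) (u : ℝ) : excess τ u ^ 2 ≤ (u - c) ^ 2 := by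
  obtain ⟨h1, h2⟩ := abs_le.1 hc
  unfold excess
  rw [sq_le_sq]
  rcases le_total τ u with h | h
  · rw [min_eq_left h, max_eq_right (by linarith), abs_of_nonneg (by linarith),
      abs_of_nonneg (by linarith)]
    linarith
  · rw [min_eq_right h]
    rcases le_total (-τ) u with h' | h'
    · simp [max_eq_right h']
    · rw [max_eq_left h', abs_of_nonpos (by linarith), abs_of_nonpos (by linarith)]
      linarith

theorem excess_zero (u : ℝ) : excess 0 u = u := by
  unfold excess
  rcases le_total 0 u with h | h <;> simp [h]

theorem excess_of_abs_le {τ u : ℝ} (h : |u| ≤ τ) : excess τ u = 0 := by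
  have := excess_sq_le h u
  simpa using this

theorem excess_sq_le_sq {τ : ℝ} (hτ : 0 ≤ τ) (u : ℝ) : excess τ u ^ 2 ≤ u ^ 2 := by
  simpa using excess_sq_le (c := 0) (by simpa using hτ) u

theorem excess_sq_le_of_abs_le {τ u w : ℝ} (hτ : 0 ≤ τ) (h : |u| ≤ |w|) :
    excess τ u ^ 2 ≤ excess τ w ^ 2 := by
  have key : ∀ z, excess τ z ^ 2 = max (|z| - τ) 0 ^ 2 := by
    intro z
    unfold excess
    rcases le_total τ z with h | h
    · rw [min_eq_left h, max_eq_right (by linarith), abs_of_nonneg (by linarith),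
        max_eq_left (by linarith)]
    · rw [min_eq_right h]
      rcases le_total (-τ) z with h' | h'
      · rw [max_eq_right h', max_eq_right (by linarith [abs_le.2 ⟨h', h⟩])]; simp
      · rw [max_eq_left h', abs_of_nonpos (by linarith), max_eq_left (by linarith)]; ring
  rw [key, key]
  have : max (|u| - τ) 0 ≤ max (|w| - τ) 0 := max_le_max (by linarith) le_rfl
  exact pow_le_pow_left₀ (le_max_right _ _) this 2

/-- Lowering the threshold by `t - s` costs at most `t - s` in the excess. -/
theorem excess_sq_le_of_le {s t : ℝ} (hs : 0 ≤ s) (hst : s ≤ t) (u : ℝ) :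
    excess s u ^ 2 ≤ 2 * excess t u ^ 2 + 2 * (t - s) ^ 2 := by
  rcases hst.eq_or_lt with rfl | hlt
  · nlinarith [sq_nonneg (excess s u)]
  have ht : 0 < t := lt_of_le_of_lt hs hlt
  -- the point of `[-s, s]` compared with is the nearest point of `[-t, t]`, scaled by `s / t`
  set c := u - excess t u with hc
  have hct : |c| ≤ t := abs_sub_excess_le ht.le u
  have h1 : |s / t * c| ≤ s := by
    rw [abs_mul, abs_of_nonneg (by positivity), div_mul_eq_mul_div, div_le_iff₀ ht]
    exact mul_le_mul_of_nonneg_left hct hs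
  have h2 := excess_sq_le h1 u
  have h3 : u - s / t * c = excess t u + (t - s) / t * c := by
    rw [hc]; field_simp; ring
  have h4 : ((t - s) / t * c) ^ 2 ≤ (t - s) ^ 2 := by
    rw [sq_le_sq, abs_mul, abs_of_nonneg (div_nonneg (sub_nonneg.2 hst) ht.le),
      abs_of_nonneg (sub_nonneg.2 hst), div_mul_eq_mul_div, div_le_iff₀ ht]
    exact mul_le_mul_of_nonneg_left hct (sub_nonneg.2 hst)
  rw [h3] at h2
  nlinarith [sq_nonneg (excess t u - (t - s) / t * c)]

/-- The half squared distance to `[-τ, τ]` has gradient `excess τ` and is `1`-smooth. -/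
theorem excess_add_sq_le {τ : ℝ} (hτ : 0 ≤ τ) (u h : ℝ) :
    excess τ (u + h) ^ 2 ≤ excess τ u ^ 2 + 2 * (excess τ u * h) + h ^ 2 := by
  have := excess_sq_le (abs_sub_excess_le hτ u) (u + h)
  nlinarith

@[fun_prop]
theorem measurable_excess (τ : ℝ) : Measurable (excess τ) := by
  unfold excess
  fun_prop

/-- The squared excess of a convex combination over the averaged threshold is at most the average of
the squared excesses. -/
theorem excess_sq_sum_le {ι : Type*} (s : Finset ι) (w τ u : ι → ℝ) (hw : ∀ i ∈ s, 0 ≤ w i)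
    (hw1 : ∑ i ∈ s, w i = 1) (hτ : ∀ i ∈ s, 0 ≤ τ i) :
    excess (∑ i ∈ s, w i * τ i) (∑ i ∈ s, w i * u i) ^ 2 ≤
      ∑ i ∈ s, w i * excess (τ i) (u i) ^ 2 := by
  have h1 : |∑ i ∈ s, w i * (u i - excess (τ i) (u i))| ≤ ∑ i ∈ s, w i * τ i := by
    refine (Finset.abs_sum_le_sum_abs _ _).trans (Finset.sum_le_sum fun i hi => ?_)
    rw [abs_mul, abs_of_nonneg (hw i hi)]
    exact mul_le_mul_of_nonneg_left (abs_sub_excess_le (hτ i hi) _) (hw i hi)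
  refine (excess_sq_le h1 _).trans ?_
  have h2 : ∑ i ∈ s, w i * u i - ∑ i ∈ s, w i * (u i - excess (τ i) (u i)) =
      ∑ i ∈ s, w i * excess (τ i) (u i) := by
    rw [← Finset.sum_sub_distrib]
    exact Finset.sum_congr rfl fun i _ => by ring
  rw [h2]
  exact Real.pow_arith_mean_le_arith_mean_pow_of_even s w _ hw hw1 even_two

/-! ### A Robbins–Monro comparison lemma -/

/-- If `a (k + 1) ≤ (1 - c / (k + 1)) a k + b k / (k + 1)` with `c > 0` and `b → 0`, then `a → 0`. -/
theorem tendsto_zero_of_recursion {a b : ℕ → ℝ} {c : ℝ} (hc : 0 < c) (ha : ∀ k, 0 ≤ a k)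
    (hb : Tendsto b atTop (𝓝 0))
    (h : ∀ᶠ k : ℕ in atTop, a (k + 1) ≤ (1 - c / ((k : ℝ) + 1)) * a k + b k / ((k : ℝ) + 1)) :
    Tendsto a atTop (𝓝 0) := by
  rw [Metric.tendsto_atTop]
  intro ε hε
  obtain ⟨K, hK⟩ := eventually_atTop.1 (h.and ((hb.eventually_lt_const
    (show 0 < c * (ε / 2) by positivity)).and
      (eventually_ge_atTop ⌈c⌉₊)))
  -- above level `ε / 2` the sequence decays like the products of the factors `1 - c / (k + 1)`
  have key : ∀ m : ℕ, a (K + m) - ε / 2 ≤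
      a K * Real.exp (-(c * (∑ i ∈ Finset.range (K + m), 1 / ((i : ℝ) + 1) -
        ∑ i ∈ Finset.range K, 1 / ((i : ℝ) + 1)))) := by
    intro m
    induction m with
    | zero => simp; linarith
    | succ m ih =>
      obtain ⟨h1, h2, h3⟩ := hK (K + m) (by omega)
      rw [← add_assoc]
      have hp : (0 : ℝ) < ((K + m : ℕ) : ℝ) + 1 := by positivity
      have hc1 : c / (((K + m : ℕ) : ℝ) + 1) ≤ 1 := by
        rw [div_le_one hp]
        have := (Nat.le_ceil c).trans (Nat.cast_le.2 h3)
        linarith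
      have h4 : a (K + m + 1) - ε / 2 ≤
          (1 - c / (((K + m : ℕ) : ℝ) + 1)) * (a (K + m) - ε / 2) := by
        have : b (K + m) / (((K + m : ℕ) : ℝ) + 1) ≤
            c / (((K + m : ℕ) : ℝ) + 1) * (ε / 2) := by
          rw [div_mul_eq_mul_div]
          gcongr
        nlinarith
      refine h4.trans ((mul_le_mul_of_nonneg_left ih (by linarith)).trans ?_)
      have h5 : 1 - c / (((K + m : ℕ) : ℝ) + 1) ≤ Real.exp (-(c / (((K + m : ℕ) : ℝ) + 1))) := by
        have := Real.add_one_le_exp (-(c / (((K + m : ℕ) : ℝ) + 1)))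
        linarith
      refine (mul_le_mul_of_nonneg_right h5 (mul_nonneg (ha K) (Real.exp_pos _).le)).trans ?_
      rw [mul_left_comm, ← Real.exp_add, Finset.sum_range_succ]
      apply le_of_eq
      congr 2
      ring
  have hlim : Tendsto (fun k : ℕ => a K * Real.exp (-(c * (∑ i ∈ Finset.range k, 1 / ((i : ℝ) + 1) -
        ∑ i ∈ Finset.range K, 1 / ((i : ℝ) + 1))))) atTop (𝓝 0) := by
    rw [← mul_zero (a K)]
    refine Tendsto.const_mul _ (Real.tendsto_exp_neg_atTop_nhds_zero.comp ?_)
    refine Tendsto.const_mul_atTop hc ?_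
    exact tendsto_atTop_add_const_right _ _ Real.tendsto_sum_range_one_div_nat_succ_atTop
  obtain ⟨K', hK'⟩ := eventually_atTop.1 (hlim.eventually_lt_const (half_pos hε))
  refine ⟨max K K', fun k hk => ?_⟩
  obtain ⟨m, rfl⟩ := Nat.exists_eq_add_of_le ((le_max_left K K').trans hk)
  have h1 := key m
  have h2 := hK' (K + m) ((le_max_right _ _).trans hk)
  rw [Real.dist_eq, sub_zero, abs_of_nonneg (ha _)]
  linarith

/-! ### The Gaussian distribution function -/

theorem gaussianPDFReal_anti {v : ℝ≥0} {x y : ℝ} (h : |x| ≤ |y|) :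
    gaussianPDFReal 0 v y ≤ gaussianPDFReal 0 v x := by
  have : x ^ 2 ≤ y ^ 2 := sq_le_sq.2 h
  simp only [gaussianPDFReal_def, sub_zero]
  gcongr

theorem cdf_gaussianReal_sub {v : ℝ≥0} (hv : 0 < v) {a b : ℝ} (hab : a ≤ b) :
    cdf (gaussianReal 0 v) b - cdf (gaussianReal 0 v) a =
      ∫ t in Set.Ioc a b, gaussianPDFReal 0 v t := by
  rw [cdf_eq_real, cdf_eq_real, ← measureReal_sdiff (Set.Iic_subset_Iic.2 hab) measurableSet_Iic,
    Set.Iic_sdiff_Iic, Measure.real, gaussianReal_apply_eq_integral 0 hv.ne',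
    ENNReal.toReal_ofReal]
  exact setIntegral_nonneg measurableSet_Ioc fun t _ => gaussianPDFReal_nonneg _ _ _

theorem cdf_gaussianReal_sub_le {v : ℝ≥0} (hv : 0 < v) {a b : ℝ} (hab : a ≤ b) :
    cdf (gaussianReal 0 v) b - cdf (gaussianReal 0 v) a ≤ gaussianPDFReal 0 v 0 * (b - a) := by
  rw [cdf_gaussianReal_sub hv hab]
  have := setIntegral_mono_on (μ := volume) (s := Set.Ioc a b)
    (integrable_gaussianPDFReal 0 v).integrableOn
    (integrableOn_const (C := gaussianPDFReal 0 v 0) (by simp)) measurableSet_Ioc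
    (fun t _ => gaussianPDFReal_anti (v := v) (by simp : |(0 : ℝ)| ≤ |t|))
  simpa [hab, mul_comm] using this

theorem le_cdf_gaussianReal_sub {v : ℝ≥0} (hv : 0 < v) {a b R : ℝ} (hab : a ≤ b) (ha : -R ≤ a)
    (hb : b ≤ R) :
    gaussianPDFReal 0 v R * (b - a) ≤ cdf (gaussianReal 0 v) b - cdf (gaussianReal 0 v) a := by
  rw [cdf_gaussianReal_sub hv hab]
  have := setIntegral_mono_on (μ := volume) (s := Set.Ioc a b)
    (integrableOn_const (C := gaussianPDFReal 0 v R) (by simp))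
    (integrable_gaussianPDFReal 0 v).integrableOn measurableSet_Ioc
    (fun t ht => gaussianPDFReal_anti (v := v) (by
      rw [abs_of_nonneg (show 0 ≤ R by linarith)]
      exact abs_le.2 ⟨by linarith [ht.1], by linarith [ht.2]⟩ : |t| ≤ |R|))
  simpa [hab, mul_comm] using this

/-- Along the drift of the estimation algorithm the excess of `u` contracts, up to the excess of `w`:
the increment of the distribution function from `b - u` to `b - w` is split at `b ∓ τ`. -/
theorem excess_mul_cdf_sub_le {v : ℝ≥0} (hv : 0 < v) {τ b u R : ℝ} (hτ : 0 ≤ τ) (w : ℝ)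
    (h0 : |b| ≤ R) (hu : |b - u| ≤ R) :
    excess τ u * (cdf (gaussianReal 0 v) (b - u) - cdf (gaussianReal 0 v) (b - w)) ≤
      -gaussianPDFReal 0 v R * excess τ u ^ 2 +
        gaussianPDFReal 0 v 0 * (|excess τ u| * |excess τ w|) := by
  set Φ := cdf (gaussianReal 0 v)
  set c := gaussianPDFReal 0 v R
  set L := gaussianPDFReal 0 v 0
  have hL : 0 ≤ L := gaussianPDFReal_nonneg _ _ _
  obtain ⟨h1, h2⟩ := abs_le.1 h0
  obtain ⟨h3, h4⟩ := abs_le.1 hu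
  have hw := abs_le.1 (abs_sub_excess_le hτ w)
  have hlip : |Φ (b - (w - excess τ w)) - Φ (b - w)| ≤ L * |excess τ w| := by
    rcases le_total 0 (excess τ w) with h | h
    · have ha := cdf_gaussianReal_sub_le hv (show b - w ≤ b - (w - excess τ w) by linarith)
      have hb := monotone_cdf (gaussianReal 0 v) (show b - w ≤ b - (w - excess τ w) by linarith)
      rw [abs_of_nonneg (sub_nonneg.2 hb), abs_of_nonneg h]
      convert ha using 2; ring
    · have ha := cdf_gaussianReal_sub_le hv (show b - (w - excess τ w) ≤ b - w by linarith)
      have hb := monotone_cdf (gaussianReal 0 v) (show b - (w - excess τ w) ≤ b - w by linarith)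
      rw [abs_of_nonpos (sub_nonpos.2 hb), abs_of_nonpos h, neg_sub]
      convert ha using 2; ring
  obtain ⟨hl1, hl2⟩ := abs_le.1 hlip
  rcases le_total |u| τ with h | h
  · simp [excess_of_abs_le h]
  rcases le_total 0 u with hu0 | hu0
  · rw [abs_of_nonneg hu0] at h
    have hex : excess τ u = u - τ := by
      unfold excess; rw [min_eq_left h, max_eq_right (by linarith)]
    have ha := le_cdf_gaussianReal_sub hv (a := b - u) (b := b - τ) (R := R) (by linarith)
      (by linarith) (by linarith)
    have hb := monotone_cdf (gaussianReal 0 v) (show b - τ ≤ b - (w - excess τ w) by linarith)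
    have h0e : 0 ≤ excess τ u := by rw [hex]; linarith
    have hc : Φ (b - u) - Φ (b - w) ≤ -c * excess τ u + L * |excess τ w| := by
      have : b - τ - (b - u) = excess τ u := by rw [hex]; ring
      rw [this] at ha
      linarith
    calc _ ≤ excess τ u * (-c * excess τ u + L * |excess τ w|) := mul_le_mul_of_nonneg_left hc h0e
      _ = _ := by rw [abs_of_nonneg h0e]; ring
  · rw [abs_of_nonpos hu0] at h
    have hex : excess τ u = u + τ := by
      unfold excess; rw [min_eq_right (by linarith), max_eq_left (by linarith)]; ring
    have ha := le_cdf_gaussianReal_sub hv (a := b + τ) (b := b - u) (R := R) (by linarith)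
      (by linarith) (by linarith)
    have hb := monotone_cdf (gaussianReal 0 v) (show b - (w - excess τ w) ≤ b + τ by linarith)
    have h0e : excess τ u ≤ 0 := by rw [hex]; linarith
    have hc : -c * excess τ u - L * |excess τ w| ≤ Φ (b - u) - Φ (b - w) := by
      have : b - u - (b + τ) = -excess τ u := by rw [hex]; ring
      rw [this] at ha
      linarith
    calc _ ≤ excess τ u * (-c * excess τ u - L * |excess τ w|) := mul_le_mul_of_nonpos_left hc h0e
      _ = _ := by rw [abs_of_nonpos h0e]; ring

/-! ### Binary observations with independent noise -/

/-- The binary observation of a quantity independent of the noise has, conditionally on that quantity,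
the mean `cdf`: it is uncorrelated after centring with every bounded function of the state. -/
theorem integral_mul_cdf_sub_indicator {Ω S : Type*} [MeasurableSpace Ω] [MeasurableSpace S]
    {μ : Measure Ω} [IsProbabilityMeasure μ] {ν : Measure ℝ} [IsProbabilityMeasure ν]
    {X : Ω → ℝ} {Z : Ω → S} (hX : Measurable X) (hZ : Measurable Z) (hν : μ.map X = ν)
    (hXZ : IndepFun X Z μ) {f g : S → ℝ} (hf : Measurable f) (hg : Measurable g) {C : ℝ}
    (hC : ∀ z, |g z| ≤ C) :
    ∫ ω, g (Z ω) * (cdf ν (f (Z ω)) - if X ω ≤ f (Z ω) then 1 else 0) ∂μ = 0 := by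
  have hmeas : Measurable fun p : S × ℝ =>
      g p.1 * (cdf ν (f p.1) - if p.2 ≤ f p.1 then 1 else 0) := by
    have h1 : Measurable (cdf ν) := (monotone_cdf ν).measurable
    have h2 : MeasurableSet {p : S × ℝ | p.2 ≤ f p.1} :=
      measurableSet_le measurable_snd (hf.comp measurable_fst)
    exact (hg.comp measurable_fst).mul ((h1.comp (hf.comp measurable_fst)).sub
      (Measurable.ite h2 measurable_const measurable_const))
  have hmap := hXZ.symm.map_prod_eq_prod_map_map hZ.aemeasurable hX.aemeasurable
  rw [hν] at hmap
  have : IsProbabilityMeasure (μ.map Z) := Measure.isProbabilityMeasure_map hZ.aemeasurable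
  rw [← integral_map (φ := fun ω => (Z ω, X ω)) (hZ.prodMk hX).aemeasurable
    (f := fun p : S × ℝ => g p.1 * (cdf ν (f p.1) - if p.2 ≤ f p.1 then 1 else 0))
    hmeas.aestronglyMeasurable, hmap, integral_prod]
  · refine integral_eq_zero_of_ae (ae_of_all _ fun z => ?_)
    have h1 : ∀ t : ℝ, (if t ≤ f z then (1 : ℝ) else 0) =
        (Set.Iic (f z)).indicator (fun _ => (1 : ℝ)) t := by
      intro t; simp [Set.indicator]
    simp only [h1, Pi.zero_apply]
    rw [integral_const_mul, integral_sub (integrable_const _)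
      ((integrable_const _).indicator measurableSet_Iic), integral_indicator measurableSet_Iic]
    simp [cdf_eq_real]
  · refine Integrable.of_bound hmeas.aestronglyMeasurable C (ae_of_all _ fun p => ?_)
    have h0 := cdf_nonneg ν (f p.1)
    have h1 := cdf_le_one ν (f p.1)
    rw [Real.norm_eq_abs, abs_mul]
    have h2 : |cdf ν (f p.1) - if p.2 ≤ f p.1 then (1 : ℝ) else 0| ≤ 1 := by
      split_ifs <;> rw [abs_le] <;> constructor <;> linarith
    calc _ ≤ |g p.1| * 1 := mul_le_mul_of_nonneg_left h2 (abs_nonneg _)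
      _ ≤ C := by simpa using hC p.1

theorem integrable_excess_sq {Ω : Type*} [MeasurableSpace Ω] {μ : Measure Ω} [IsFiniteMeasure μ]
    {τ : ℝ} (hτ : 0 ≤ τ) {Y : Ω → ℝ} (hY : Measurable Y) {C : ℝ} (hC : ∀ ω, |Y ω| ≤ C) :
    Integrable (fun ω => excess τ (Y ω) ^ 2) μ := by
  refine Integrable.of_bound (by fun_prop : Measurable _).aestronglyMeasurable (C ^ 2)
    (ae_of_all _ fun ω => ?_)
  rw [Real.norm_eq_abs, abs_of_nonneg (sq_nonneg _)]
  refine (excess_sq_le_sq hτ _).trans ?_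
  rw [← sq_abs]
  exact pow_le_pow_left₀ (abs_nonneg _) (hC ω) 2

theorem integrable_sq {Ω : Type*} [MeasurableSpace Ω] {μ : Measure Ω} [IsFiniteMeasure μ]
    {Y : Ω → ℝ} (hY : Measurable Y) {C : ℝ} (hC : ∀ ω, |Y ω| ≤ C) :
    Integrable (fun ω => Y ω ^ 2) μ := by
  simpa only [excess_zero] using integrable_excess_sq (μ := μ) le_rfl hY hC

/-! ### Bounds and measurability of the trajectories -/

namespace Params

variable {n : ℕ} (P : Params n) {Ω : Type*} (ξ : ℕ → Fin n → Fin (n + 1) → Ω → ℝ)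

theorem x_succ (k : ℕ) (ω : Ω) (i : Fin n) :
    P.x ξ (k + 1) ω i.castSucc = P.x ξ k ω i.castSucc - 1 / ((k : ℝ) + 1) *
      ∑ j ∈ neighbors P.G i.castSucc, (P.x ξ k ω i.castSucc - P.xhat ξ k ω i j) := by
  simp [x, xhat, traj, nextState, adjacency]

theorem xhat_succ (k : ℕ) (ω : Ω) {i : Fin n} {j : Fin (n + 1)}
    (hj : j ∈ neighbors P.G i.castSucc) :
    P.xhat ξ (k + 1) ω i j = P.proj (P.xhat ξ k ω i j + P.β / ((k : ℝ) + 1) *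
      (P.F (P.B i j - P.xhat ξ k ω i j) -
        P.obs i j (P.x ξ (k + 1) ω j) (ξ (k + 1) i j ω))) := by
  simp [x, xhat, traj, nextEstimate, hj]

theorem xhat_of_notMem (k : ℕ) (ω : Ω) {i : Fin n} {j : Fin (n + 1)}
    (hj : j ∉ neighbors P.G i.castSucc) : P.xhat ξ k ω i j = 0 := by
  cases k <;> simp [xhat, traj, nextEstimate, hj]

variable {P}

theorem abs_proj_sub_le {c : ℝ} (hc : |c| ≤ P.W) (y : ℝ) : |P.proj y - c| ≤ |y - c| := by
  obtain ⟨h1, h2⟩ := abs_le.1 hc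
  unfold proj
  rcases le_total P.W y with h | h
  · rw [min_eq_left h, max_eq_right (by linarith), abs_of_nonneg (by linarith),
      abs_of_nonneg (by linarith)]
    linarith
  · rw [min_eq_right h]
    rcases le_total (-P.W) y with h' | h'
    · rw [max_eq_right h']
    · rw [max_eq_left h', abs_of_nonpos (by linarith), abs_of_nonpos (by linarith)]
      linarith

theorem abs_proj_le (hW : 0 ≤ P.W) (y : ℝ) : |P.proj y| ≤ P.W :=
  abs_le.2 ⟨le_max_left _ _, max_le (by linarith) (min_le_left _ _)⟩

variable {ξ}

theorem abs_xhat_le (hW : 0 ≤ P.W)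
    (h0 : ∀ i : Fin n, ∀ j ∈ neighbors P.G i.castSucc, |P.xhat0 i j| ≤ P.W)
    (k : ℕ) (ω : Ω) (i : Fin n) (j : Fin (n + 1)) : |P.xhat ξ k ω i j| ≤ P.W := by
  by_cases hj : j ∈ neighbors P.G i.castSucc
  · cases k with
    | zero => simpa [xhat, traj, hj] using h0 i j hj
    | succ k => rw [xhat_succ P ξ k ω hj]; exact abs_proj_le hW _
  · rw [xhat_of_notMem P ξ k ω hj]; simpa using hW

theorem exists_abs_x_le (hW : 0 ≤ P.W)
    (h0 : ∀ i : Fin n, ∀ j ∈ neighbors P.G i.castSucc, |P.xhat0 i j| ≤ P.W) (k : ℕ)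
    (i : Fin (n + 1)) : ∃ C, ∀ ω, |P.x ξ k ω i| ≤ C := by
  refine Fin.lastCases ⟨|P.leaderState k|, fun ω => by rw [x_last]⟩ (fun i => ?_) i
  induction k with
  | zero => exact ⟨|P.x0 i.castSucc|, fun ω => by simp [x, traj]⟩
  | succ k ih =>
    obtain ⟨C, hC⟩ := ih
    refine ⟨C + |1 / ((k : ℝ) + 1)| * ∑ j ∈ neighbors P.G i.castSucc, (C + P.W), fun ω => ?_⟩
    rw [x_succ]
    refine (abs_sub _ _).trans (add_le_add (hC ω) ?_)
    rw [abs_mul]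
    refine mul_le_mul_of_nonneg_left ?_ (abs_nonneg _)
    refine (Finset.abs_sum_le_sum_abs _ _).trans (Finset.sum_le_sum fun j _ => ?_)
    exact (abs_sub _ _).trans (add_le_add (hC ω) (abs_xhat_le hW h0 k ω i j))

theorem measurable_F : Measurable P.F := (monotone_cdf (gaussianReal 0 P.v)).measurable

theorem measurable_proj : Measurable P.proj := by
  unfold proj
  fun_prop

variable [MeasurableSpace Ω]

theorem measurable_state
    (hξ : ∀ (k : ℕ) (i : Fin n), ∀ j ∈ neighbors P.G i.castSucc, Measurable (ξ (k + 1) i j))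
    (k : ℕ) : (∀ i, Measurable fun ω => P.x ξ k ω i) ∧
      ∀ i j, Measurable fun ω => P.xhat ξ k ω i j := by
  induction k with
  | zero =>
    refine ⟨fun i => ?_, fun i j => ?_⟩
    · simp [x, traj]
    · simp [xhat, traj]
  | succ k ih =>
    have hx : ∀ i, Measurable fun ω => P.x ξ (k + 1) ω i := by
      refine fun i => Fin.lastCases ?_ (fun i => ?_) i
      · simp [x_last]
      · simp only [x_succ]
        exact (ih.1 _).sub ((Finset.measurable_fun_sum _ fun j _ =>
          (ih.1 _).sub (ih.2 i j)).const_mul _)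
    refine ⟨hx, fun i j => ?_⟩
    by_cases hj : j ∈ neighbors P.G i.castSucc
    · simp only [xhat_succ P ξ k _ hj, obs]
      refine measurable_proj.comp ((ih.2 i j).add (Measurable.const_mul (Measurable.sub
        (measurable_F.comp (measurable_const.sub (ih.2 i j)))
        (Measurable.ite ?_ measurable_const measurable_const)) _))
      exact measurableSet_le ((hx j).add (hξ k i j hj)) measurable_const
    · simp [xhat_of_notMem P ξ _ _ hj]

end Params

/-! ### Propagation of the asymptotic bounds -/

section Propagation

variable {n : ℕ} {P : Params n} {Ω : Type*} [MeasurableSpace Ω] {μ : Measure Ω}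
  [IsProbabilityMeasure μ] {ξ : ℕ → Fin n → Fin (n + 1) → Ω → ℝ} {xstar : ℝ}

/-- An estimate inherits the asymptotic bound `τ` on the distance to `xstar` from the estimated
state. -/
theorem tendsto_excess_xhat (hβ : 0 < P.β) (hv : 0 < P.v) (hξ : GaussianNoise P μ ξ)
    (h0 : ∀ i : Fin n, ∀ j ∈ neighbors P.G i.castSucc, |P.xhat0 i j| ≤ P.W)
    (hstar : |xstar| ≤ P.W) {i : Fin n} {j : Fin (n + 1)} (hj : j ∈ neighbors P.G i.castSucc)
    {τ : ℝ} (hτ : 0 ≤ τ)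
    (h : Tendsto (fun k => ∫ ω, excess τ (P.x ξ k ω j - xstar) ^ 2 ∂μ) atTop (𝓝 0)) :
    Tendsto (fun k => ∫ ω, excess τ (P.xhat ξ k ω i j - xstar) ^ 2 ∂μ) atTop (𝓝 0) := by
  have hW : 0 ≤ P.W := (abs_nonneg _).trans hstar
  have hm := Params.measurable_state (P := P) fun k i j hj => (hξ k i j hj).1
  set R := |P.B i j| + P.W with hR
  set c := gaussianPDFReal 0 P.v R with hc
  have hcpos : 0 < c := gaussianPDFReal_pos _ _ _ hv.ne'
  set L := gaussianPDFReal 0 P.v 0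
  have hinv : Tendsto (fun k : ℕ => 1 / ((k : ℝ) + 1)) atTop (𝓝 0) :=
    tendsto_one_div_add_atTop_nhds_zero_nat
  have hb : Tendsto (fun k : ℕ => P.β * (L ^ 2 / c) *
      (∫ ω, excess τ (P.x ξ (k + 1) ω j - xstar) ^ 2 ∂μ) + P.β ^ 2 * (1 / ((k : ℝ) + 1)))
      atTop (𝓝 0) := by
    have := ((h.comp (tendsto_add_atTop_nat 1)).const_mul (P.β * (L ^ 2 / c))).add
      (hinv.const_mul (P.β ^ 2))
    simpa using this
  refine tendsto_zero_of_recursion (c := c * P.β) (by positivity)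
    (fun k => integral_nonneg fun ω => sq_nonneg _) hb (Eventually.of_forall fun k => ?_)
  obtain ⟨hmξ, hlaw, hind⟩ := hξ k i j hj
  obtain ⟨C, hC⟩ := Params.exists_abs_x_le (ξ := ξ) hW h0 (k + 1) j
  have hxb : ∀ ω, |P.x ξ (k + 1) ω j - xstar| ≤ C + P.W := fun ω =>
    (abs_sub _ _).trans (add_le_add (hC ω) hstar)
  have hyb : ∀ k ω, |P.xhat ξ k ω i j - xstar| ≤ P.W + P.W := fun k ω =>
    (abs_sub _ _).trans (add_le_add (Params.abs_xhat_le hW h0 k ω i j) hstar)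
  have hxm : Measurable fun ω => P.x ξ (k + 1) ω j - xstar := ((hm (k + 1)).1 j).sub_const _
  have hym : ∀ k, Measurable fun ω => P.xhat ξ k ω i j - xstar :=
    fun k => ((hm k).2 i j).sub_const _
  set s := P.β / ((k : ℝ) + 1) with hs
  have hspos : 0 < s := by positivity
  let e : Ω → ℝ := fun ω => excess τ (P.xhat ξ k ω i j - xstar)
  let p : Ω → ℝ := fun ω => excess τ (P.x ξ (k + 1) ω j - xstar)
  -- the centred observation
  let N : Ω → ℝ := fun ω => P.F (P.B i j - P.x ξ (k + 1) ω j) -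
    P.obs i j (P.x ξ (k + 1) ω j) (ξ (k + 1) i j ω)
  have hF0 : ∀ y, 0 ≤ P.F y := fun y => cdf_nonneg _ y
  have hF1 : ∀ y, P.F y ≤ 1 := fun y => cdf_le_one _ y
  have hobs : ∀ y z, 0 ≤ P.obs i j y z ∧ P.obs i j y z ≤ 1 := by
    intro y z; unfold Params.obs; split_ifs <;> norm_num
  have hpt : ∀ ω, excess τ (P.xhat ξ (k + 1) ω i j - xstar) ^ 2 ≤
      (1 - c * s) * e ω ^ 2 + s * (L ^ 2 / c) * p ω ^ 2 + 2 * s * (e ω * N ω) + s ^ 2 := by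
    intro ω
    set y := P.xhat ξ k ω i j with hy
    set z := P.x ξ (k + 1) ω j with hz
    set h := P.F (P.B i j - y) - P.obs i j z (ξ (k + 1) i j ω) with hh
    have hab : h ^ 2 ≤ 1 := by
      have h1 := hobs z (ξ (k + 1) i j ω)
      rw [sq_le_one_iff_abs_le_one, abs_le]
      constructor <;> linarith [hF0 (P.B i j - y), hF1 (P.B i j - y)]
    have h1 : excess τ (P.xhat ξ (k + 1) ω i j - xstar) ^ 2 ≤ excess τ (y - xstar + s * h) ^ 2 := by
      refine excess_sq_le_of_abs_le hτ ?_
      rw [P.xhat_succ ξ k ω hj]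
      refine (Params.abs_proj_sub_le hstar _).trans (le_of_eq ?_)
      congr 1
      ring
    have h2 := excess_add_sq_le hτ (y - xstar) (s * h)
    have h3 := excess_mul_cdf_sub_le hv (b := P.B i j - xstar) (u := y - xstar) (R := R) hτ
      (z - xstar) ((abs_sub _ _).trans (by linarith)) (by
        have : P.B i j - xstar - (y - xstar) = P.B i j - y := by ring
        rw [this]
        exact (abs_sub _ _).trans (by linarith [Params.abs_xhat_le (ξ := ξ) hW h0 k ω i j]))
    rw [show P.B i j - xstar - (y - xstar) = P.B i j - y by ring,
      show P.B i j - xstar - (z - xstar) = P.B i j - z by ring] at h3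
    change e ω * (P.F (P.B i j - y) - P.F (P.B i j - z)) ≤
      -c * e ω ^ 2 + L * (|e ω| * |p ω|) at h3
    have h4 : L * (|e ω| * |p ω|) ≤ c / 2 * e ω ^ 2 + L ^ 2 / c / 2 * p ω ^ 2 := by
      have h5 : 0 ≤ (c * |e ω| - L * |p ω|) ^ 2 / (2 * c) := by positivity
      have h6 : (c * |e ω| - L * |p ω|) ^ 2 / (2 * c) =
          c / 2 * |e ω| ^ 2 + L ^ 2 / c / 2 * |p ω| ^ 2 - L * (|e ω| * |p ω|) := by
        field_simp; ring
      rw [sq_abs, sq_abs] at h6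
      linarith
    have h7 : h = (P.F (P.B i j - y) - P.F (P.B i j - z)) + N ω := by
      simp only [hh, N, ← hz]; ring
    have h8 : e ω * h ≤ -(c / 2) * e ω ^ 2 + L ^ 2 / c / 2 * p ω ^ 2 + e ω * N ω := by
      rw [h7, mul_add]; linarith
    have h9 := mul_le_mul_of_nonneg_left h8 hspos.le
    have h10 := mul_le_mul_of_nonneg_left hab (sq_nonneg s)
    have h11 : excess τ (y - xstar) = e ω := rfl
    rw [h11] at h2
    refine h1.trans (h2.trans ?_)
    linarith
  have he2 : Integrable (fun ω => e ω ^ 2) μ := integrable_excess_sq hτ (hym k) (hyb k)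
  have hp2 : Integrable (fun ω => p ω ^ 2) μ := integrable_excess_sq hτ hxm hxb
  -- projecting the estimate leaves it unchanged, and makes its excess a bounded function of the state
  have hN0 : ∫ ω, e ω * N ω ∂μ = 0 := by
    have := integral_mul_cdf_sub_indicator (μ := μ) (ν := gaussianReal 0 P.v) hmξ
      (Z := fun ω => (P.x ξ (k + 1) ω, P.xhat ξ k ω))
      ((measurable_pi_lambda _ (hm (k + 1)).1).prodMk
        (measurable_pi_lambda _ fun i => measurable_pi_lambda _ ((hm k).2 i))) hlaw hind
      (f := fun z => P.B i j - z.1 j) (g := fun z => excess τ (P.proj (z.2 i j) - xstar))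
      (by fun_prop) ((measurable_excess τ).comp ((Params.measurable_proj.comp
        (by fun_prop)).sub_const _)) (C := P.W + P.W) (fun z => by
          refine (sq_le_sq.1 ?_).trans ((abs_sub _ _).trans
            (add_le_add (Params.abs_proj_le hW (z.2 i j)) hstar))
          exact excess_sq_le_sq hτ _)
    rw [← this]
    refine integral_congr_ae (ae_of_all _ fun ω => ?_)
    have h1 : P.proj (P.xhat ξ k ω i j) = P.xhat ξ k ω i j := by
      obtain ⟨h1, h2⟩ := abs_le.1 (Params.abs_xhat_le (ξ := ξ) hW h0 k ω i j)
      rw [Params.proj, min_eq_right h2, max_eq_right h1]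
    simp only [e, N, h1, Params.F, Params.obs, ← le_sub_iff_add_le']
  have hNm : Measurable N := by
    refine (Params.measurable_F.comp (measurable_const.sub ((hm (k + 1)).1 j))).sub ?_
    exact Measurable.ite (measurableSet_le (((hm (k + 1)).1 j).add hmξ) measurable_const)
      measurable_const measurable_const
  have heN : Integrable (fun ω => e ω * N ω) μ := by
    refine Integrable.mono' (he2.add (integrable_const (1 : ℝ)))
      (((measurable_excess τ).comp (hym k)).mul hNm).aestronglyMeasurable
      (ae_of_all _ fun ω => ?_)
    have h1 : |N ω| ≤ 1 := by
      have h1 := hobs (P.x ξ (k + 1) ω j) (ξ (k + 1) i j ω)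
      have h2 := hF0 (P.B i j - P.x ξ (k + 1) ω j)
      have h3 := hF1 (P.B i j - P.x ξ (k + 1) ω j)
      rw [abs_le]
      constructor <;> simp only [N] <;> linarith
    rw [Real.norm_eq_abs, abs_mul]
    refine (mul_le_mul_of_nonneg_left h1 (abs_nonneg _)).trans ?_
    simp only [Pi.add_apply]
    rw [← sq_abs (e ω)]
    nlinarith [sq_nonneg (|e ω| - 1)]
  calc ∫ ω, excess τ (P.xhat ξ (k + 1) ω i j - xstar) ^ 2 ∂μ
      ≤ ∫ ω, ((1 - c * s) * e ω ^ 2 + s * (L ^ 2 / c) * p ω ^ 2 + 2 * s * (e ω * N ω) + s ^ 2) ∂μ :=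
        integral_mono (integrable_excess_sq hτ (hym (k + 1)) (hyb (k + 1)))
          ((((he2.const_mul _).add (hp2.const_mul _)).add (heN.const_mul _)).add
            (integrable_const _)) hpt
    _ = (1 - c * s) * (∫ ω, e ω ^ 2 ∂μ) + s * (L ^ 2 / c) * (∫ ω, p ω ^ 2 ∂μ) + s ^ 2 := by
        have hsum := (he2.const_mul (1 - c * s)).add (hp2.const_mul (s * (L ^ 2 / c)))
        rw [integral_add (f := fun ω => (1 - c * s) * e ω ^ 2 + s * (L ^ 2 / c) * p ω ^ 2 +
            2 * s * (e ω * N ω)) (hsum.add (heN.const_mul _)) (integrable_const _),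
          integral_add (f := fun ω => (1 - c * s) * e ω ^ 2 + s * (L ^ 2 / c) * p ω ^ 2)
            hsum (heN.const_mul _),
          integral_add (he2.const_mul _) (hp2.const_mul _)]
        simp only [integral_const_mul, hN0]
        simp
    _ = _ := by
        simp only [hs, e, p]
        field_simp
        ring

/-- The state of a follower is asymptotically bounded by the average of the asymptotic bounds of its
estimates. -/
theorem tendsto_excess_x
    (hξ : ∀ (k : ℕ) (i : Fin n), ∀ j ∈ neighbors P.G i.castSucc, Measurable (ξ (k + 1) i j))
    (h0 : ∀ i : Fin n, ∀ j ∈ neighbors P.G i.castSucc, |P.xhat0 i j| ≤ P.W)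
    (hstar : |xstar| ≤ P.W) {i : Fin n} (hi : (neighbors P.G i.castSucc).Nonempty)
    {t : Fin (n + 1) → ℝ} (ht : ∀ j, 0 ≤ t j)
    (h : ∀ j ∈ neighbors P.G i.castSucc,
      Tendsto (fun k => ∫ ω, excess (t j) (P.xhat ξ k ω i j - xstar) ^ 2 ∂μ) atTop (𝓝 0)) :
    Tendsto (fun k => ∫ ω, excess ((∑ j ∈ neighbors P.G i.castSucc, t j) /
      (neighbors P.G i.castSucc).card) (P.x ξ k ω i.castSucc - xstar) ^ 2 ∂μ) atTop (𝓝 0) := by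
  have hW : 0 ≤ P.W := (abs_nonneg _).trans hstar
  have hm := Params.measurable_state (P := P) hξ
  set s := neighbors P.G i.castSucc with hs
  set d : ℝ := (s.card : ℝ) with hd
  have hdpos : 0 < d := Nat.cast_pos.2 hi.card_pos
  set τ := (∑ j ∈ s, t j) / d with hτ
  have hτ0 : 0 ≤ τ := div_nonneg (Finset.sum_nonneg fun j _ => ht j) hdpos.le
  have hb := tendsto_finsetSum s h
  rw [Finset.sum_const_zero] at hb
  refine tendsto_zero_of_recursion hdpos (fun k => integral_nonneg fun ω => sq_nonneg _) hb ?_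
  filter_upwards [eventually_ge_atTop s.card] with k hk
  have hk1 : (0 : ℝ) < (k : ℝ) + 1 := by positivity
  have hw0 : 0 ≤ 1 - d / ((k : ℝ) + 1) := by
    rw [sub_nonneg, div_le_one hk1]
    have : d ≤ k := Nat.cast_le.2 hk
    linarith
  have hpt : ∀ ω, excess τ (P.x ξ (k + 1) ω i.castSucc - xstar) ^ 2 ≤
      (1 - d / ((k : ℝ) + 1)) * excess τ (P.x ξ k ω i.castSucc - xstar) ^ 2 +
        ∑ j ∈ s, 1 / ((k : ℝ) + 1) * excess (t j) (P.xhat ξ k ω i j - xstar) ^ 2 := by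
    intro ω
    have := excess_sq_sum_le (Finset.insertNone s)
      (fun o => o.elim (1 - d / ((k : ℝ) + 1)) fun _ => 1 / ((k : ℝ) + 1))
      (fun o => o.elim τ t)
      (fun o => o.elim (P.x ξ k ω i.castSucc - xstar) fun j => P.xhat ξ k ω i j - xstar)
      (by rintro (_ | j) _
          · exact hw0
          · simp only [Option.elim]; positivity)
      (by rw [Finset.sum_insertNone]
          simp only [Option.elim, Finset.sum_const, nsmul_eq_mul, ← hd]
          ring)
      (by rintro (_ | j) _
          · exact hτ0
          · exact ht j)
    simp only [Finset.sum_insertNone, Option.elim] at this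
    convert this using 3
    · rw [← Finset.mul_sum, hτ]
      field_simp
      ring
    · rw [P.x_succ, ← hs, ← Finset.mul_sum, Finset.sum_sub_distrib, Finset.sum_sub_distrib,
        Finset.sum_const, Finset.sum_const, nsmul_eq_mul, nsmul_eq_mul, ← hd]
      field_simp
      ring
  have hxi : ∀ k, Integrable (fun ω => excess τ (P.x ξ k ω i.castSucc - xstar) ^ 2) μ := by
    intro k
    obtain ⟨C, hC⟩ := Params.exists_abs_x_le (ξ := ξ) hW h0 k i.castSucc
    exact integrable_excess_sq hτ0 (((hm k).1 _).sub_const _) fun ω =>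
      (abs_sub _ _).trans (add_le_add (hC ω) hstar)
  have hyi : ∀ j, Integrable (fun ω => excess (t j) (P.xhat ξ k ω i j - xstar) ^ 2) μ := fun j =>
    integrable_excess_sq (ht j) (((hm k).2 i j).sub_const _) fun ω =>
      (abs_sub _ _).trans (add_le_add (Params.abs_xhat_le hW h0 k ω i j) hstar)
  refine (integral_mono (hxi (k + 1)) (((hxi k).const_mul _).add
    (integrable_finsetSum _ fun j _ => (hyi j).const_mul _)) hpt).trans (le_of_eq ?_)
  rw [integral_add' ((hxi k).const_mul _) (integrable_finsetSum _ fun j _ => (hyi j).const_mul _),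
    integral_const_mul, integral_finsetSum _ fun j _ => (hyi j).const_mul _]
  simp only [integral_const_mul]
  rw [← Finset.mul_sum, one_div_mul_eq_div]

/-! ### The maximum principle -/

/-- The states of all agents converge to `xstar` in mean square. -/
theorem tendsto_x (hβ : 0 < P.β) (hv : 0 < P.v) (hξ : GaussianNoise P μ ξ)
    (htree : ∃ T : Digraph (Fin (n + 1)), T ≤ P.G ∧ IsSpanningTree T (Fin.last n))
    (h0 : ∀ i : Fin n, ∀ j ∈ neighbors P.G i.castSucc, |P.xhat0 i j| ≤ P.W)
    (hconv : Tendsto P.leaderState atTop (𝓝 xstar)) (hstar : |xstar| ≤ P.W) (i : Fin (n + 1)) :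
    Tendsto (fun k => ∫ ω, (P.x ξ k ω i - xstar) ^ 2 ∂μ) atTop (𝓝 0) := by
  obtain ⟨T, hTG, hT0, hT1, hT2⟩ := htree
  have hW : 0 ≤ P.W := (abs_nonneg _).trans hstar
  have hξm := fun k i j hj => (hξ k i j hj).1
  have hm := Params.measurable_state (P := P) hξm
  have hnb : ∀ {u v}, T.Adj u v → u ∈ neighbors P.G v := by
    intro u v huv
    simpa [neighbors] using hTG huv
  have hne : ∀ i : Fin n, (neighbors P.G i.castSucc).Nonempty := fun i =>
    let ⟨u, hu, _⟩ := hT1 i.castSucc (Fin.castSucc_lt_last i).ne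
    ⟨u, hnb hu⟩
  -- the asymptotic mean-square bounds for the distance of agent `j` to `xstar`
  let S : Fin (n + 1) → Set ℝ := fun j =>
    {τ | 0 ≤ τ ∧ Tendsto (fun k => ∫ ω, excess τ (P.x ξ k ω j - xstar) ^ 2 ∂μ) atTop (𝓝 0)}
  have hbdd : ∀ j, BddBelow (S j) := fun j => ⟨0, fun τ hτ => hτ.1⟩
  have hlast : (0 : ℝ) ∈ S (Fin.last n) := by
    refine ⟨le_rfl, ?_⟩
    simp only [excess_zero, Params.x_last, integral_const, probReal_univ, one_smul]
    have := (hconv.sub_const xstar).pow 2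
    simpa using this
  have hnonempty : ∀ j, (S j).Nonempty := by
    intro j
    refine Fin.lastCases ⟨0, hlast⟩ (fun j => ?_) j
    refine ⟨_, by positivity, tendsto_excess_x hξm h0 hstar (hne j)
      (t := fun _ => P.W + P.W) (fun _ => by positivity) fun l _ => ?_⟩
    have : ∀ k ω, excess (P.W + P.W) (P.xhat ξ k ω j l - xstar) = 0 := fun k ω =>
      excess_of_abs_le ((abs_sub _ _).trans
        (add_le_add (Params.abs_xhat_le hW h0 k ω j l) hstar))
    simp [this]
  let t : Fin (n + 1) → ℝ := fun j => sInf (S j)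
  have ht0 : ∀ j, 0 ≤ t j := fun j => Real.sInf_nonneg fun τ hτ => hτ.1
  have hmem : ∀ j, t j ∈ S j := by
    intro j
    refine ⟨ht0 j, ?_⟩
    rw [Metric.tendsto_atTop]
    intro ε hε
    obtain ⟨τ, hτ, hlt⟩ := exists_lt_of_csInf_lt (hnonempty j)
      (show sInf (S j) < t j + Real.sqrt (ε / 4) from lt_add_of_pos_right _ (by positivity))
    have hle : t j ≤ τ := csInf_le (hbdd j) hτ
    obtain ⟨K, hK⟩ := eventually_atTop.1 (hτ.2.eventually_lt_const (show 0 < ε / 4 by positivity))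
    refine ⟨K, fun k hk => ?_⟩
    rw [Real.dist_eq, sub_zero, abs_of_nonneg (integral_nonneg fun ω => sq_nonneg _)]
    obtain ⟨C, hC⟩ := Params.exists_abs_x_le (ξ := ξ) hW h0 k j
    have hint : ∀ σ, 0 ≤ σ → Integrable (fun ω => excess σ (P.x ξ k ω j - xstar) ^ 2) μ :=
      fun σ hσ => integrable_excess_sq hσ (((hm k).1 _).sub_const _) fun ω =>
        (abs_sub _ _).trans (add_le_add (hC ω) hstar)
    have h1 := integral_mono (hint _ (ht0 j))
      (((hint τ hτ.1).const_mul 2).add (integrable_const (2 * (τ - t j) ^ 2)))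
      fun ω => excess_sq_le_of_le (ht0 j) hle _
    simp only [Pi.add_apply] at h1
    rw [integral_add ((hint τ hτ.1).const_mul 2) (integrable_const _), integral_const_mul] at h1
    simp only [integral_const, probReal_univ, one_smul] at h1
    have h2 : (τ - t j) ^ 2 ≤ ε / 4 := by
      rw [← Real.sq_sqrt (show 0 ≤ ε / 4 by positivity)]
      exact pow_le_pow_left₀ (by linarith) (by linarith) 2
    linarith [hK k hk]
  have havg : ∀ j : Fin n, t j.castSucc ≤
      (∑ l ∈ neighbors P.G j.castSucc, t l) / (neighbors P.G j.castSucc).card := fun j =>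
    csInf_le (hbdd _) ⟨div_nonneg (Finset.sum_nonneg fun l _ => ht0 l) (Nat.cast_nonneg _),
      tendsto_excess_x hξm h0 hstar (hne j) ht0 fun l hl =>
        tendsto_excess_xhat hβ hv hξ h0 hstar hl (ht0 l) (hmem l).2⟩
  have htlast : t (Fin.last n) = 0 := le_antisymm (csInf_le (hbdd _) hlast) (ht0 _)
  obtain ⟨m, -, hmax⟩ := Finset.exists_max_image Finset.univ t ⟨Fin.last n, Finset.mem_univ _⟩
  -- the maximum of `t` is attained on all neighbours of a follower on which it is attained
  have hprop : ∀ v, Relation.ReflTransGen T.Adj (Fin.last n) v → t v = t m → t m = 0 := by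
    intro v hv
    induction hv with
    | refl => intro h; rw [← h, htlast]
    | @tail b c _ hbc ih =>
      intro hcm
      induction c using Fin.lastCases with
      | last => rw [← hcm, htlast]
      | cast c =>
        refine ih (le_antisymm (hmax b (Finset.mem_univ _)) ?_)
        by_contra! hlt
        have hsum : ∑ l ∈ neighbors P.G c.castSucc, t l <
            ∑ l ∈ neighbors P.G c.castSucc, t m :=
          Finset.sum_lt_sum (fun l _ => hmax l (Finset.mem_univ _)) ⟨b, hnb hbc, hlt⟩
        have h1 := havg c
        rw [hcm, le_div_iff₀ (by exact_mod_cast (hne c).card_pos)] at h1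
        rw [Finset.sum_const, nsmul_eq_mul] at hsum
        linarith
  have hti : t i = 0 :=
    le_antisymm ((hmax i (Finset.mem_univ _)).trans (hprop m (hT2 m) rfl).le) (ht0 i)
  have := (hmem i).2
  rw [hti] at this
  simpa only [excess_zero] using this

end Propagation

/-! ### Mean-square convergence of differences -/

/-- Mean-square convergence to a common limit implies mean-square convergence of the difference. -/
theorem tendsto_integral_sub_sq {Ω : Type*} [MeasurableSpace Ω] {μ : Measure Ω}
    [IsFiniteMeasure μ] {X Y : ℕ → Ω → ℝ} {c : ℝ}
    (hX : ∀ k, Integrable (fun ω => (X k ω - c) ^ 2) μ)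
    (hY : ∀ k, Integrable (fun ω => (Y k ω - c) ^ 2) μ)
    (hXY : ∀ k, Integrable (fun ω => (X k ω - Y k ω) ^ 2) μ)
    (hX0 : Tendsto (fun k => ∫ ω, (X k ω - c) ^ 2 ∂μ) atTop (𝓝 0))
    (hY0 : Tendsto (fun k => ∫ ω, (Y k ω - c) ^ 2 ∂μ) atTop (𝓝 0)) :
    Tendsto (fun k => ∫ ω, (X k ω - Y k ω) ^ 2 ∂μ) atTop (𝓝 0) := by
  have hlim := (hX0.const_mul 2).add (hY0.const_mul 2)
  simp only [mul_zero, add_zero] at hlim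
  refine squeeze_zero (fun k => integral_nonneg fun ω => sq_nonneg _) (fun k => ?_) hlim
  rw [← integral_const_mul, ← integral_const_mul,
    ← integral_add ((hX k).const_mul 2) ((hY k).const_mul 2)]
  refine integral_mono (hXY k) (((hX k).const_mul 2).add ((hY k).const_mul 2)) fun ω => ?_
  nlinarith [sq_nonneg ((X k ω - c) + (Y k ω - c))]

end BinaryTracking

theorem theorem1 {n : ℕ} (P : BinaryTracking.Params n)
    {Ω : Type*} [MeasurableSpace Ω] (μ : Measure Ω) [IsProbabilityMeasure μ]
    (ξ : ℕ → Fin n → Fin (n + 1) → Ω → ℝ)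
    -- the leader receives no information from the followers
    (hleader : ∀ i : Fin n, ¬ P.G.Adj i.castSucc (Fin.last n))
    -- the topology contains a directed spanning tree with the leader as its root
    (htree : ∃ T : Digraph (Fin (n + 1)), T ≤ P.G ∧ BinaryTracking.IsSpanningTree T (Fin.last n))
    -- the initial states of the followers and the initial estimates are bounded by `W`
    (hx0 : ∀ i : Fin n, |P.x0 i.castSucc| ≤ P.W)
    (hxhat0 : ∀ i : Fin n, ∀ j ∈ BinaryTracking.neighbors P.G i.castSucc, |P.xhat0 i j| ≤ P.W)
    -- the noises
    (hv : 0 < P.v)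
    (hξ : BinaryTracking.GaussianNoise P μ ξ)
    -- the state of the leader converges, to a limit in the range of the projection
    (xstar : ℝ) (hconv : Tendsto P.leaderState atTop (𝓝 xstar)) (hstar : |xstar| ≤ P.W)
    -- the condition on the coefficient of the step size
    {𝕜 : Type*} [RCLike 𝕜] (D : BinaryTracking.LyapunovData 𝕜 P.G)
    (hβ : BinaryTracking.l₁ D / P.fB < P.β) :
    (∀ i : Fin n, ∀ j ∈ BinaryTracking.neighbors P.G i.castSucc, i.castSucc ≠ j →
      (∀ k, Integrable (fun ω => (P.xhat ξ k ω i j - P.x ξ k ω j) ^ 2) μ) ∧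
      Tendsto (fun k => ∫ ω, (P.xhat ξ k ω i j - P.x ξ k ω j) ^ 2 ∂μ) atTop (𝓝 0)) ∧
    (∀ i : Fin (n + 1),
      (∀ k, Integrable (fun ω => (P.x ξ k ω i - P.x ξ k ω (Fin.last n)) ^ 2) μ) ∧
      Tendsto (fun k => ∫ ω, (P.x ξ k ω i - P.x ξ k ω (Fin.last n)) ^ 2 ∂μ) atTop (𝓝 0)) := by
  have hW : 0 ≤ P.W := (abs_nonneg _).trans hstar
  have hβ0 : 0 < P.β :=
    (div_nonneg (BinaryTracking.l₁_nonneg D) P.fB_nonneg).trans_lt hβ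
  have hm := BinaryTracking.Params.measurable_state (P := P) fun k i j hj => (hξ k i j hj).1
  have hxb := BinaryTracking.Params.exists_abs_x_le (ξ := ξ) hW hxhat0
  have hyb := BinaryTracking.Params.abs_xhat_le (ξ := ξ) hW hxhat0
  have hx := BinaryTracking.tendsto_x hβ0 hv hξ htree hxhat0 hconv hstar
  have hx2 : ∀ i k, Integrable (fun ω => (P.x ξ k ω i - xstar) ^ 2) μ := fun i k =>
    let ⟨_, hC⟩ := hxb k i
    BinaryTracking.integrable_sq (((hm k).1 i).sub_const _) fun ω =>
      (abs_sub _ _).trans (add_le_add (hC ω) hstar)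
  have hy2 : ∀ i j k, Integrable (fun ω => (P.xhat ξ k ω i j - xstar) ^ 2) μ := fun i j k =>
    BinaryTracking.integrable_sq (((hm k).2 i j).sub_const _) fun ω =>
      (abs_sub _ _).trans (add_le_add (hyb k ω i j) hstar)
  have hyx : ∀ i j k, Integrable (fun ω => (P.xhat ξ k ω i j - P.x ξ k ω j) ^ 2) μ := fun i j k =>
    let ⟨_, hC⟩ := hxb k j
    BinaryTracking.integrable_sq (((hm k).2 i j).sub ((hm k).1 j)) fun ω =>
      (abs_sub _ _).trans (add_le_add (hyb k ω i j) (hC ω))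
  have hxx : ∀ i j k, Integrable (fun ω => (P.x ξ k ω i - P.x ξ k ω j) ^ 2) μ := fun i j k =>
    let ⟨_, hC⟩ := hxb k i
    let ⟨_, hC'⟩ := hxb k j
    BinaryTracking.integrable_sq (((hm k).1 i).sub ((hm k).1 j)) fun ω =>
      (abs_sub _ _).trans (add_le_add (hC ω) (hC' ω))
  refine ⟨fun i j hj _ => ⟨hyx i j, ?_⟩, fun i => ⟨hxx i _, ?_⟩⟩
  · refine BinaryTracking.tendsto_integral_sub_sq (hy2 i j) (hx2 j) (hyx i j) ?_ (hx j)
    have := BinaryTracking.tendsto_excess_xhat hβ0 hv hξ hxhat0 hstar hj le_rfl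
      (by simpa only [BinaryTracking.excess_zero] using hx j)
    simpa only [BinaryTracking.excess_zero] using this
  · exact BinaryTracking.tendsto_integral_sub_sq (hx2 i) (hx2 _) (hxx i _) (hx i) (hx _)
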